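/- Let $\mu_1,\dots,\mu_p\in\mathbb{R}^N$, let $\Sigma_1,\dots,\Sigma_q\in\mathbb{R}^{N\times N}$ be symmetric positive definite, $a\in\mathbb{R}^p$, $b\in\mathbb{R}^q$, and $\mathcal{W}=\{w\in\mathbb{R}^N: w\ge 0,\ \mathbf{1}^{\mathsf T}w=1\}$. Put $x_i(w)=w^{\mathsf T}\mu_i$, $y_j(w)=w^{\mathsf T}\Sigma_j w$, $g(w)=[a-x(w);\,y(w)-b]\in\mathbb{R}^{p+q}$ and $\mathcal{K}=\{w\in\mathcal{W}: g(w)\le 0\}$, and suppose that some $w\in\mathcal{W}$ satisfies $g(w)<0$ in every component. Let $F:\mathbb{R}^p\times\mathbb{R}^q\to\mathbb{R}$ be differentiable at $(x(w),y(w))$ for every $w\in\mathcal{K}$, and assume (Assumption 1) that, on the points $(x(w),y(w))$ with $w\in\mathcal{K}$, each partial derivative $\nabla_{x_i}F$ that is not identically $0$ is everywhere negative and each $\nabla_{y_j}F$ that is not identically $0$ is everywhere positive. Fix $w^k\in\mathcal{K}$, let $x^k=x(w^k)$, $y^k=y(w^k)$, $\lambda^k=[-\nabla_xF(x^k,y^k);\,\nabla_yF(x^k,y^k)]$,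 and consider the convexified subproblem $$\min_{w\in\mathcal{K}}\ \tilde f(w;w^k)=\nabla_xF(x^k,y^k)^{\mathsf T}x(w)+\nabla_yF(x^k,y^k)^{\mathsf T}y(w).\qquad(\ast)$$ For $\eta=[\eta_x;\eta_y]\ge 0$ let $h(\eta;\lambda^k)=\inf_{w\in\mathcal{W}}\{\tilde f(w;w^k)+\eta^{\mathsf T}g(w)\}$ and let $\hat w(\lambda^k,\eta)$ denote a solution of the quadratic program $\min_{w\in\mathcal{W}}\ -(\lambda^k_x+\eta_x)^{\mathsf T}x(w)+(\lambda^k_y+\eta_y)^{\mathsf T}y(w)$. Let $\alpha^{\mathrm{init}}>0$, $\sigma,\beta\in(0,1)$, $\eta^0\ge 0$, and for $l=0,1,\dots$ let $$\eta^{l+1}=\big[\eta^l+\alpha^l g(\hat w(\lambda^k,\eta^l))\big]_+,$$ where $\alpha^l$ is chosen by the Armijo rule along the projection arc, i.e. $\alpha^l$ is the largest element of $\{\alpha^{\mathrm{init}}\beta^j\}_{j=0,1,\dots}$ for which $$h(\eta^{l+1};\lambda^k)-h(\eta^l;\lambda^k)\ \ge\ \sigma\, g(\hat w(\lambda^k,\eta^l))^{\mathsf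 T}(\eta^{l+1}-\eta^l).$$ Suppose that the quadratic program has a unique solution at every iterate $\eta=\eta^l$ and at every limit point $\eta$ of $\{\eta^l\}$ (this is automatic if some component of $\nabla_yF(x^k,y^k)$ is nonzero). Then the subproblem $(\ast)$ has a unique optimal solution, and the sequence $\hat w(\lambda^k,\eta^l)$, $l=1,2,\dots$, converges to it. -/

import Mathlib

open Filter Topology
open scoped Matrix

noncomputable section

/-- Data of a general mean-variance portfolio problem with `N` assets, `p` mean estimates and
`q` covariance estimates: minimize `F (x(w), y(w))` over the budget simplex subject to
`a i ≤ x i (w)` and `y j (w) ≤ b j`. -/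
structure MVP (N p q : ℕ) where
  /-- mean vectors -/
  μ : Fin p → Fin N → ℝ
  /-- covariance matrices -/
  S : Fin q → Matrix (Fin N) (Fin N) ℝ
  /-- lower limits on the expected returns -/
  a : Fin p → ℝ
  /-- upper limits on the risks -/
  b : Fin q → ℝ
  /-- objective as a function of means and variances -/
  F : (Fin p → ℝ) × (Fin q → ℝ) → ℝ

namespace MVP

variable {N p q : ℕ} (P : MVP N p q)

/-- Expected returns `x_i(w) = wᵀ μ_i`. -/
def x (w : Fin N → ℝ) : Fin p → ℝ := fun i => w ⬝ᵥ P.μ i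

/-- Risks `y_j(w) = wᵀ Σ_j w`. -/
def y (w : Fin N → ℝ) : Fin q → ℝ := fun j => w ⬝ᵥ (P.S j *ᵥ w)

/-- The set of long-only portfolios with unit budget. -/
def W (_P : MVP N p q) : Set (Fin N → ℝ) := {w | (∀ i, 0 ≤ w i) ∧ ∑ i, w i = 1}

/-- The feasible set. -/
def K : Set (Fin N → ℝ) :=
  {w | w ∈ P.W ∧ (∀ i, P.a i ≤ P.x w i) ∧ (∀ j, P.y w j ≤ P.b j)}

/-- Points of the simplex at which all mean-variance constraints hold strictly. -/
def IsStrictlyFeasible (w : Fin N → ℝ) : Prop :=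
  w ∈ P.W ∧ (∀ i, P.a i < P.x w i) ∧ (∀ j, P.y w j < P.b j)

/-- The compact constraint function `g(w) = [a - x(w); y(w) - b]`. -/
def g (w : Fin N → ℝ) : Fin p ⊕ Fin q → ℝ :=
  Sum.elim (fun i => P.a i - P.x w i) (fun j => P.y w j - P.b j)

/-- The partial derivative of `F` in `x_i`, at `(x(w), y(w))`. -/
def dFx (w : Fin N → ℝ) (i : Fin p) : ℝ :=
  fderiv ℝ P.F (P.x w, P.y w) (Pi.single i 1, 0)

/-- The partial derivative of `F` in `y_j`, at `(x(w), y(w))`. -/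
def dFy (w : Fin N → ℝ) (j : Fin q) : ℝ :=
  fderiv ℝ P.F (P.x w, P.y w) (0, Pi.single j 1)

/-- `x_i` exists in `F`: its partial derivative does not always vanish. -/
def XExists (i : Fin p) : Prop := ∃ w ∈ P.K, P.dFx w i ≠ 0

/-- `y_j` exists in `F`: its partial derivative does not always vanish. -/
def YExists (j : Fin q) : Prop := ∃ w ∈ P.K, P.dFy w j ≠ 0

/-- Rational risk-return trade-off: `F` has negative partial derivatives in the means and positive
ones in the variances that exist in it. -/
def RationalTradeoff : Prop :=
  (∀ i, P.XExists i → ∀ w ∈ P.K, P.dFx w i < 0) ∧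
  (∀ j, P.YExists j → ∀ w ∈ P.K, 0 < P.dFy w j)

/-- The convexified objective `f̃(w; wk) = ∇ₓF(xᵏ, yᵏ)ᵀ x(w) + ∇_yF(xᵏ, yᵏ)ᵀ y(w)`. -/
def fTilde (wk w : Fin N → ℝ) : ℝ := P.dFx wk ⬝ᵥ P.x w + P.dFy wk ⬝ᵥ P.y w

/-- `w` is an optimal solution of the convexified subproblem: minimize `f̃(·; wk)` over `K`. -/
def IsSubproblemSolution (wk w : Fin N → ℝ) : Prop :=
  w ∈ P.K ∧ IsMinOn (P.fTilde wk) P.K w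

/-- The weights `λᵏ = [-∇ₓF(xᵏ, yᵏ); ∇_yF(xᵏ, yᵏ)]`. -/
def lam (wk : Fin N → ℝ) : Fin p ⊕ Fin q → ℝ :=
  Sum.elim (fun i => -P.dFx wk i) (fun j => P.dFy wk j)

/-- Objective of the QP surrogate problem,
`-(λₓ + ηₓ)ᵀ x(w) + (λ_y + η_y)ᵀ y(w)`. -/
def qpObjective (lam η : Fin p ⊕ Fin q → ℝ) (w : Fin N → ℝ) : ℝ :=
  -(∑ i : Fin p, (lam (Sum.inl i) + η (Sum.inl i)) * P.x w i)
    + ∑ j : Fin q, (lam (Sum.inr j) + η (Sum.inr j)) * P.y w j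

/-- `w` solves the QP surrogate problem with weights `lam` and `η`. -/
def IsQPSolution (lam η : Fin p ⊕ Fin q → ℝ) (w : Fin N → ℝ) : Prop :=
  w ∈ P.W ∧ IsMinOn (P.qpObjective lam η) P.W w

/-- Partial Lagrangian of the convexified subproblem,
`f̃(w; wk) - ηₓᵀ (x(w) - a) + η_yᵀ (y(w) - b)`. -/
def lagrangian (wk w : Fin N → ℝ) (η : Fin p ⊕ Fin q → ℝ) : ℝ :=
  P.fTilde wk w - ∑ i : Fin p, η (Sum.inl i) * (P.x w i - P.a i)
    + ∑ j : Fin q, η (Sum.inr j) * (P.y w j - P.b j)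

/-- Lagrangian dual function `h(η; λᵏ)`, the infimum of the partial Lagrangian over the simplex. -/
def dual (wk : Fin N → ℝ) (η : Fin p ⊕ Fin q → ℝ) : ℝ :=
  sInf ((fun w => P.lagrangian wk w η) '' P.W)

/-- The projection arc `[η + α g(w)]₊`. -/
def arc (η : Fin p ⊕ Fin q → ℝ) (w : Fin N → ℝ) (α : ℝ) : Fin p ⊕ Fin q → ℝ :=
  fun c => max 0 (η c + α * P.g w c)

/-- The sufficient-increase test of the Armijo rule along the projection arc. -/
def ArmijoTest (wk : Fin N → ℝ) (σ : ℝ) (η : Fin p ⊕ Fin q → ℝ) (w : Fin N → ℝ) (α : ℝ) : Prop :=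
  P.dual wk (P.arc η w α) - P.dual wk η ≥ σ * (P.g w ⬝ᵥ (P.arc η w α - η))

/-- A run of the inner loop at the outer iterate `wk`: multipliers `η l`, step sizes `α l` and QP
solutions `wHat l`, with the Armijo rule along the projection arc. -/
structure IsInnerLoop (wk : Fin N → ℝ) (αinit σ β : ℝ)
    (η : ℕ → Fin p ⊕ Fin q → ℝ) (α : ℕ → ℝ) (wHat : ℕ → Fin N → ℝ) : Prop where
  /-- the initial multipliers are nonnegative -/
  init : ∀ c, 0 ≤ η 0 c
  /-- `wHat l` solves the QP surrogate problem with weights `λᵏ` and `η l` -/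
  qp : ∀ l, P.IsQPSolution (P.lam wk) (η l) (wHat l)
  /-- `α l` is the largest of the numbers `αinit * β ^ j` passing the Armijo test -/
  armijo : ∀ l, IsGreatest
    {t : ℝ | (∃ j : ℕ, t = αinit * β ^ j) ∧ P.ArmijoTest wk σ (η l) (wHat l) t} (α l)
  /-- projected gradient step -/
  update : ∀ l, η (l + 1) = P.arc (η l) (wHat l) (α l)

end MVP

end

/-! The loop is projected gradient ascent on the concave dual `h`, with `g` at the QP solution as
supergradient. By the Armijo rule the dual values increase. A Slater point bounds them above and
confines the multipliers to a box. Hence cluster points `ζ` exist, and the predicted increase tends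
to 0.

At a cluster point, uniqueness of the QP solution makes the solutions continuous in the multipliers,
so they tend to some `v`; then `v` and `ζ` are feasible and complementary
(`complementarity_of_tendsto`). Weak duality turns this into optimality of `v`, and QP uniqueness at
`ζ` makes `v` the only optimum. All cluster points therefore give the same `v`, although the
multipliers need not converge. Ultrafilters play the role of subsequences. -/

/-- For a projected step of a nonnegative coordinate, the displacement has the sign of the
direction. -/
theorem mul_projStep_nonneg {e g t : ℝ} (he : 0 ≤ e) (ht : 0 ≤ t) :
    0 ≤ g * (max 0 (e + t * g) - e) := by
  rcases le_total 0 g with hg | hg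
  · have := mul_nonneg ht hg
    exact mul_nonneg hg (by linarith [le_max_right 0 (e + t * g)])
  · have := mul_nonpos_of_nonneg_of_nonpos ht hg
    exact mul_nonneg_of_nonpos_of_nonpos hg (sub_nonpos.2 (max_le he (by linarith)))

/-- The displacement of a projected step is at most that of the free step. -/
theorem abs_projStep_le {e g t : ℝ} (he : 0 ≤ e) (ht : 0 ≤ t) :
    |max 0 (e + t * g) - e| ≤ t * |g| := by
  have h := abs_max_sub_max_le_abs (e + t * g) e 0
  rwa [max_comm _ (0 : ℝ), max_eq_left he, add_sub_cancel_left, abs_mul, abs_of_nonneg ht] at h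

/-- The relative displacement along the projection arc decreases with the step size. -/
theorem mul_projStep_antitone {e g s t : ℝ} (he : 0 ≤ e) (hs : 0 ≤ s) (hst : s ≤ t) :
    s * (g * (max 0 (e + t * g) - e)) ≤ t * (g * (max 0 (e + s * g) - e)) := by
  rcases le_total 0 g with hg | hg
  · rw [max_eq_right (by nlinarith [mul_nonneg hs hg, mul_nonneg (hs.trans hst) hg]),
      max_eq_right (by nlinarith [mul_nonneg hs hg])]
    exact le_of_eq (by ring)
  -- For `g ≤ 0` the displacement is `max (-e) (t * g)`; divided by `t` it is `max (-e / t) g`,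
  -- nondecreasing in `t`.
  · have key : t * (max 0 (e + s * g) - e) ≤ s * (max 0 (e + t * g) - e) := by
      rcases le_total 0 (e + s * g) with h | h
      · rw [max_eq_right h]
        nlinarith [mul_le_mul_of_nonneg_left (le_max_right 0 (e + t * g)) hs]
      · rw [max_eq_left h]
        nlinarith [mul_le_mul_of_nonneg_left (le_max_left 0 (e + t * g)) hs,
          mul_le_mul_of_nonneg_right hst he]
    nlinarith [mul_le_mul_of_nonpos_left key hg]

/-- Fixed points of the projected step are complementary. -/
theorem complementarity_of_mul_projStep_eq_zero {e g t : ℝ} (he : 0 ≤ e) (ht : 0 < t)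
    (h : g * (max 0 (e + t * g) - e) = 0) : g ≤ 0 ∧ e * g = 0 := by
  rcases mul_eq_zero.1 h with h | h
  · simp [h]
  · rcases le_total 0 (e + t * g) with h' | h'
    · rw [max_eq_right h', add_sub_cancel_left] at h
      have : g = 0 := (mul_eq_zero.1 h).resolve_left ht.ne'
      simp [this]
    · rw [max_eq_left h', zero_sub, neg_eq_zero] at h
      subst h
      exact ⟨by nlinarith, zero_mul _⟩

/-! ### Lagrangian duality and stability of the QP solutions -/

namespace MVP

variable {N p q : ℕ} (P : MVP N p q)

theorem continuous_x : Continuous P.x := by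
  unfold x dotProduct
  fun_prop

theorem continuous_y : Continuous P.y := by
  unfold y dotProduct Matrix.mulVec dotProduct
  fun_prop

theorem continuous_g : Continuous P.g := by
  refine continuous_pi fun c => ?_
  have hx := P.continuous_x
  have hy := P.continuous_y
  rcases c with i | j <;> simp only [g, Sum.elim_inl, Sum.elim_inr] <;> fun_prop

theorem continuous_fTilde (wk : Fin N → ℝ) : Continuous (P.fTilde wk) := by
  have hx := P.continuous_x
  have hy := P.continuous_y
  unfold fTilde dotProduct
  fun_prop

theorem isCompact_W : IsCompact P.W := by
  have h : P.W = stdSimplex ℝ (Fin N) := rfl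
  exact h ▸ isCompact_stdSimplex ℝ (Fin N)

theorem lagrangian_eq (wk w : Fin N → ℝ) (η : Fin p ⊕ Fin q → ℝ) :
    P.lagrangian wk w η = P.fTilde wk w + η ⬝ᵥ P.g w := by
  simp only [lagrangian, dotProduct, Fintype.sum_sum_type, g, Sum.elim_inl, Sum.elim_inr,
    mul_sub, Finset.sum_sub_distrib]
  ring

theorem continuous_lagrangian (wk : Fin N → ℝ) :
    Continuous fun z : (Fin N → ℝ) × (Fin p ⊕ Fin q → ℝ) => P.lagrangian wk z.1 z.2 := by
  have hf := P.continuous_fTilde wk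
  have hg := P.continuous_g
  simp only [lagrangian_eq, dotProduct]
  fun_prop

theorem isQPSolution_iff (wk w : Fin N → ℝ) (η : Fin p ⊕ Fin q → ℝ) :
    P.IsQPSolution (P.lam wk) η w ↔
      w ∈ P.W ∧ ∀ v ∈ P.W, P.lagrangian wk w η ≤ P.lagrangian wk v η := by
  -- The two objectives differ by a term independent of the portfolio.
  have h : ∀ v, P.lagrangian wk v η = P.qpObjective (P.lam wk) η v
      + ((∑ i, η (Sum.inl i) * P.a i) - ∑ j, η (Sum.inr j) * P.b j) := by
    intro v
    simp only [lagrangian, qpObjective, fTilde, lam, dotProduct, Sum.elim_inl, Sum.elim_inr,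
      mul_sub, add_mul, neg_mul, Finset.sum_sub_distrib, Finset.sum_add_distrib,
      Finset.sum_neg_distrib]
    ring
  simp only [h, add_le_add_iff_right]
  exact Iff.rfl

theorem exists_isQPSolution (wk : Fin N → ℝ) (hW : P.W.Nonempty) (η : Fin p ⊕ Fin q → ℝ) :
    ∃ w, P.IsQPSolution (P.lam wk) η w := by
  obtain ⟨w, hw, hmin⟩ := P.isCompact_W.exists_isMinOn hW
    (f := fun w => P.lagrangian wk w η)
    ((P.continuous_lagrangian wk).comp (by fun_prop : Continuous fun w => (w, η))).continuousOn
  exact ⟨w, (P.isQPSolution_iff wk w η).2 ⟨hw, fun v hv => hmin hv⟩⟩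

variable {P}

theorem IsQPSolution.dual_eq {wk w : Fin N → ℝ} {η : Fin p ⊕ Fin q → ℝ}
    (h : P.IsQPSolution (P.lam wk) η w) : P.dual wk η = P.lagrangian wk w η := by
  obtain ⟨hw, hmin⟩ := (P.isQPSolution_iff wk w η).1 h
  refine IsLeast.csInf_eq ⟨⟨w, hw, rfl⟩, ?_⟩
  rintro _ ⟨v, hv, rfl⟩
  exact hmin v hv

theorem dual_le_lagrangian {wk v : Fin N → ℝ} (hv : v ∈ P.W) (η : Fin p ⊕ Fin q → ℝ) :
    P.dual wk η ≤ P.lagrangian wk v η := by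
  obtain ⟨w, hw⟩ := P.exists_isQPSolution wk ⟨v, hv⟩ η
  rw [hw.dual_eq]
  exact ((P.isQPSolution_iff wk w η).1 hw).2 v hv

/-- The constraint values at a QP solution are a supergradient of the dual function. -/
theorem IsQPSolution.dual_le_add {wk w : Fin N → ℝ} {η : Fin p ⊕ Fin q → ℝ}
    (h : P.IsQPSolution (P.lam wk) η w) (ζ : Fin p ⊕ Fin q → ℝ) :
    P.dual wk ζ ≤ P.dual wk η + P.g w ⬝ᵥ (ζ - η) := by
  have := dual_le_lagrangian (wk := wk) h.1 ζ
  rw [h.dual_eq]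
  rw [lagrangian_eq] at this ⊢
  rw [dotProduct_sub, dotProduct_comm _ ζ, dotProduct_comm _ η]
  linarith

/-- QP solutions depend continuously on the multipliers where the solution is unique. -/
theorem tendsto_of_isQPSolution {ι : Type*} {l : Filter ι} {wk w₀ : Fin N → ℝ}
    {ζ : ι → Fin p ⊕ Fin q → ℝ} {ζ₀ : Fin p ⊕ Fin q → ℝ} {w : ι → Fin N → ℝ}
    (hw : ∀ᶠ i in l, P.IsQPSolution (P.lam wk) (ζ i) (w i)) (hζ : Tendsto ζ l (𝓝 ζ₀))
    (huniq : ∀ v, P.IsQPSolution (P.lam wk) ζ₀ v → v = w₀) : Tendsto w l (𝓝 w₀) := by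
  rw [tendsto_iff_ultrafilter]
  intro U hU
  have hwW : ∀ᶠ i in (U : Filter ι), w i ∈ P.W := (hw.filter_mono hU).mono fun i hi => hi.1
  obtain ⟨v, hv, hle⟩ := P.isCompact_W.ultrafilter_le_nhds (U.map w) (le_principal_iff.2 hwW)
  have hwv : Tendsto w U (𝓝 v) := hle
  have : P.IsQPSolution (P.lam wk) ζ₀ v := by
    refine (P.isQPSolution_iff wk v ζ₀).2 ⟨hv, fun u hu => ?_⟩
    have hL := P.continuous_lagrangian wk
    refine le_of_tendsto_of_tendsto
      ((hL.tendsto (v, ζ₀)).comp (hwv.prodMk_nhds (hζ.mono_left hU)))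
      ((hL.tendsto (u, ζ₀)).comp ((tendsto_const_nhds (x := u)).prodMk_nhds (hζ.mono_left hU)))
      ((hw.filter_mono hU).mono fun i hi => ?_)
    exact ((P.isQPSolution_iff wk _ _).1 hi).2 u hu
  exact huniq v this ▸ hwv

/-- A QP solution satisfying the complementarity conditions solves the subproblem, and it is the
only solution if the QP solution is unique. -/
theorem IsQPSolution.isSubproblemSolution {wk w : Fin N → ℝ} {η : Fin p ⊕ Fin q → ℝ}
    (h : P.IsQPSolution (P.lam wk) η w) (hη : ∀ c, 0 ≤ η c)
    (hc : ∀ c, P.g w c ≤ 0 ∧ η c * P.g w c = 0)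
    (huniq : ∀ v, P.IsQPSolution (P.lam wk) η v → v = w) :
    P.IsSubproblemSolution wk w ∧ ∀ v, P.IsSubproblemSolution wk v → v = w := by
  obtain ⟨hw, hmin⟩ := (P.isQPSolution_iff wk w η).1 h
  have hLw : P.lagrangian wk w η = P.fTilde wk w := by
    rw [lagrangian_eq, dotProduct, Finset.sum_eq_zero fun c _ => (hc c).2, add_zero]
  have hLv : ∀ v ∈ P.K, P.lagrangian wk v η ≤ P.fTilde wk v := by
    intro v hv
    have : η ⬝ᵥ P.g v ≤ 0 := Finset.sum_nonpos fun c _ =>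
      mul_nonpos_of_nonneg_of_nonpos (hη c) (by
        rcases c with i | j
        · exact sub_nonpos.2 (hv.2.1 i)
        · exact sub_nonpos.2 (hv.2.2 j))
    rw [lagrangian_eq]
    linarith
  have hwK : w ∈ P.K := ⟨hw, fun i => sub_nonpos.1 (hc (Sum.inl i)).1,
    fun j => sub_nonpos.1 (hc (Sum.inr j)).1⟩
  refine ⟨⟨hwK, fun v hv => ?_⟩, fun v hv => huniq v ?_⟩
  · exact hLw ▸ (hmin v hv.1).trans (hLv v hv)
  -- Any other optimum also minimizes the Lagrangian at `η`: `L(v) ≤ f̃(v) ≤ f̃(w) = L(w) ≤ L(u)`.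
  · refine (P.isQPSolution_iff wk v η).2 ⟨hv.1.1, fun u hu => ?_⟩
    exact (hLv v hv.1).trans ((hv.2 hwK).trans (hLw ▸ hmin u hu))

/-! ### The projection arc -/

theorem arc_nonneg (η : Fin p ⊕ Fin q → ℝ) (w : Fin N → ℝ) (t : ℝ) (c : Fin p ⊕ Fin q) :
    0 ≤ P.arc η w t c := le_max_left _ _

variable (P) in
theorem continuous_arc :
    Continuous fun z : (Fin p ⊕ Fin q → ℝ) × (Fin N → ℝ) × ℝ => P.arc z.1 z.2.1 z.2.2 := by
  have hg := P.continuous_g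
  unfold arc
  fun_prop

theorem mul_arc_sub_nonneg {η : Fin p ⊕ Fin q → ℝ} (hη : ∀ c, 0 ≤ η c) (w : Fin N → ℝ) {t : ℝ}
    (ht : 0 ≤ t) (c : Fin p ⊕ Fin q) : 0 ≤ P.g w c * (P.arc η w t - η) c :=
  mul_projStep_nonneg (hη c) ht

theorem dotProduct_arc_sub_nonneg {η : Fin p ⊕ Fin q → ℝ} (hη : ∀ c, 0 ≤ η c)
    (w : Fin N → ℝ) {t : ℝ} (ht : 0 ≤ t) : 0 ≤ P.g w ⬝ᵥ (P.arc η w t - η) :=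
  Finset.sum_nonneg fun c _ => mul_arc_sub_nonneg hη w ht c

theorem complementarity_of_dotProduct_arc_sub_eq_zero {η : Fin p ⊕ Fin q → ℝ}
    (hη : ∀ c, 0 ≤ η c) {w : Fin N → ℝ} {t : ℝ} (ht : 0 < t)
    (h : P.g w ⬝ᵥ (P.arc η w t - η) = 0) (c : Fin p ⊕ Fin q) :
    P.g w c ≤ 0 ∧ η c * P.g w c = 0 :=
  complementarity_of_mul_projStep_eq_zero (hη c) ht
    ((Finset.sum_eq_zero_iff_of_nonneg fun c _ => mul_arc_sub_nonneg hη w ht.le c).1 h c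
      (Finset.mem_univ c))

/-- If the Armijo test fails for a step `s ≤ t`, the stationarity measure for `t` is controlled by
the variation of the constraint values along the arc. -/
theorem dotProduct_arc_sub_le_of_not_armijoTest {wk w v : Fin N → ℝ} {η : Fin p ⊕ Fin q → ℝ}
    {σ s t : ℝ} (hη : ∀ c, 0 ≤ η c) (hs : 0 < s) (hst : s ≤ t) (hσ : σ < 1)
    (hv : P.IsQPSolution (P.lam wk) (P.arc η w s) v) (hfail : ¬ P.ArmijoTest wk σ η w s) :
    (1 - σ) * (P.g w ⬝ᵥ (P.arc η w t - η)) ≤ t * ∑ c, |P.g w c - P.g v c| * |P.g w c| := by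
  set d := P.arc η w s - η with hd
  -- The supergradient at the trial point gives an increase of at least `g(v)ᵀd`, while failure of
  -- the test makes it less than `σ g(w)ᵀd`.
  have h1 : (1 - σ) * (P.g w ⬝ᵥ d) ≤ (P.g w - P.g v) ⬝ᵥ d := by
    have hsup := hv.dual_le_add η
    rw [← neg_sub, ← hd, dotProduct_neg] at hsup
    simp only [ArmijoTest, not_le, ge_iff_le, ← hd] at hfail
    rw [sub_dotProduct]
    linarith
  have h2 : (P.g w - P.g v) ⬝ᵥ d ≤ s * ∑ c, |P.g w c - P.g v c| * |P.g w c| := by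
    rw [Finset.mul_sum]
    refine Finset.sum_le_sum fun c _ => (le_abs_self _).trans ?_
    rw [abs_mul, mul_left_comm]
    exact mul_le_mul_of_nonneg_left (abs_projStep_le (hη c) hs.le) (abs_nonneg _)
  have h3 : s * (P.g w ⬝ᵥ (P.arc η w t - η)) ≤ t * (P.g w ⬝ᵥ d) := by
    simp only [dotProduct, Finset.mul_sum]
    exact Finset.sum_le_sum fun c _ => mul_projStep_antitone (hη c) hs.le hst
  refine le_of_mul_le_mul_left ?_ hs
  have ht := hs.le.trans hst
  calc s * ((1 - σ) * (P.g w ⬝ᵥ (P.arc η w t - η)))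
      = (1 - σ) * (s * (P.g w ⬝ᵥ (P.arc η w t - η))) := by ring
    _ ≤ (1 - σ) * (t * (P.g w ⬝ᵥ d)) := mul_le_mul_of_nonneg_left h3 (sub_nonneg.2 hσ.le)
    _ = t * ((1 - σ) * (P.g w ⬝ᵥ d)) := by ring
    _ ≤ t * (s * ∑ c, |P.g w c - P.g v c| * |P.g w c|) :=
        mul_le_mul_of_nonneg_left (h1.trans h2) ht
    _ = _ := by ring

/-! ### Convergence of the inner loop -/

namespace IsInnerLoop

variable {wk : Fin N → ℝ} {αinit σ β : ℝ} {η : ℕ → Fin p ⊕ Fin q → ℝ} {α : ℕ → ℝ}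
  {wHat : ℕ → Fin N → ℝ}

theorem nonneg (h : P.IsInnerLoop wk αinit σ β η α wHat) (l : ℕ) (c : Fin p ⊕ Fin q) :
    0 ≤ η l c := by
  cases l with
  | zero => exact h.init c
  | succ l => rw [h.update]; exact arc_nonneg _ _ _ c

theorem step_pos (h : P.IsInnerLoop wk αinit σ β η α wHat) (hα : 0 < αinit) (hβ : 0 < β)
    (l : ℕ) : 0 < α l := by
  obtain ⟨j, hj⟩ := (h.armijo l).1.1
  rw [hj]
  positivity

theorem step_le (h : P.IsInnerLoop wk αinit σ β η α wHat) (hα : 0 < αinit)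
    (hβ : β ∈ Set.Ioo (0 : ℝ) 1) (l : ℕ) : α l ≤ αinit := by
  obtain ⟨j, hj⟩ := (h.armijo l).1.1
  rw [hj]
  exact mul_le_of_le_one_right hα.le (pow_le_one₀ hβ.1.le hβ.2.le)

/-- A step that was reduced fails the Armijo test before its last reduction. -/
theorem not_armijoTest_div (h : P.IsInnerLoop wk αinit σ β η α wHat) (hα : 0 < αinit)
    (hβ : β ∈ Set.Ioo (0 : ℝ) 1) {l : ℕ} (hl : α l < αinit) :
    ¬ P.ArmijoTest wk σ (η l) (wHat l) (α l / β) := by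
  intro htest
  have hpos := h.step_pos hα hβ.1 l
  obtain ⟨j, hj⟩ := (h.armijo l).1.1
  cases j with
  | zero => simp [hj] at hl
  | succ j =>
    have hle := (h.armijo l).2
      ⟨⟨j, by rw [hj, pow_succ, ← mul_assoc, mul_div_cancel_right₀ _ hβ.1.ne']⟩, htest⟩
    rw [div_le_iff₀ hβ.1] at hle
    nlinarith [hβ.2]

theorem sufficient_increase (h : P.IsInnerLoop wk αinit σ β η α wHat) (l : ℕ) :
    σ * (P.g (wHat l) ⬝ᵥ (P.arc (η l) (wHat l) (α l) - η l)) ≤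
      P.dual wk (η (l + 1)) - P.dual wk (η l) := by
  rw [h.update]
  exact (h.armijo l).1.2

theorem monotone_dual (h : P.IsInnerLoop wk αinit σ β η α wHat) (hα : 0 < αinit) (hσ : 0 ≤ σ)
    (hβ : 0 < β) : Monotone fun l => P.dual wk (η l) :=
  monotone_nat_of_le_succ fun l => sub_nonneg.1 <| (mul_nonneg hσ
    (dotProduct_arc_sub_nonneg (h.nonneg l) _ (h.step_pos hα hβ l).le)).trans
      (h.sufficient_increase l)

/-- At a Slater point every term of `ηᵀg` is nonpositive, so all but one can be dropped from `h(η) ≤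
f̃ + ηᵀg`. As the dual values increase, this bounds each multiplier. -/
theorem mul_slack_le (h : P.IsInnerLoop wk αinit σ β η α wHat) {w : Fin N → ℝ} (hw : w ∈ P.W)
    (hg : ∀ c, P.g w c < 0) (l : ℕ) (c : Fin p ⊕ Fin q) :
    P.dual wk (η l) + η l c * -P.g w c ≤ P.fTilde wk w := by
  have h1 := dual_le_lagrangian (wk := wk) hw (η l)
  have h2 : η l c * -P.g w c ≤ ∑ c, η l c * -P.g w c :=
    Finset.single_le_sum (f := fun c => η l c * -P.g w c)
      (fun c _ => mul_nonneg (h.nonneg l c) (neg_nonneg.2 (hg c).le)) (Finset.mem_univ c)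
  simp only [mul_neg, Finset.sum_neg_distrib] at h2 ⊢
  rw [lagrangian_eq, dotProduct] at h1
  linarith

theorem dual_le_fTilde (h : P.IsInnerLoop wk αinit σ β η α wHat) {w : Fin N → ℝ} (hw : w ∈ P.W)
    (hg : ∀ c, P.g w c < 0) (l : ℕ) : P.dual wk (η l) ≤ P.fTilde wk w := by
  have h1 := dual_le_lagrangian (wk := wk) hw (η l)
  have h2 : η l ⬝ᵥ P.g w ≤ 0 := Finset.sum_nonpos fun c _ =>
    mul_nonpos_of_nonneg_of_nonpos (h.nonneg l c) (hg c).le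
  rw [lagrangian_eq] at h1
  linarith

theorem exists_forall_le (h : P.IsInnerLoop wk αinit σ β η α wHat) (hα : 0 < αinit)
    (hσ : 0 ≤ σ) (hβ : 0 < β) {w : Fin N → ℝ} (hw : w ∈ P.W) (hg : ∀ c, P.g w c < 0) :
    ∃ M, ∀ l, η l ∈ Set.Icc 0 M := by
  refine ⟨fun c => (P.fTilde wk w - P.dual wk (η 0)) / -P.g w c,
    fun l => ⟨fun c => h.nonneg l c, fun c => ?_⟩⟩
  have h1 := h.mul_slack_le hw hg l c
  have h2 := h.monotone_dual hα hσ hβ (Nat.zero_le l)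
  simp only at h2
  rw [le_div_iff₀ (neg_pos.2 (hg c))]
  linarith

/-- The dual values are monotone and bounded, so their increments vanish; these dominate `σ` times
the predicted increase. -/
theorem tendsto_dotProduct_step (h : P.IsInnerLoop wk αinit σ β η α wHat) (hα : 0 < αinit)
    (hσ : 0 < σ) (hβ : 0 < β) {w : Fin N → ℝ} (hw : w ∈ P.W) (hg : ∀ c, P.g w c < 0) :
    Tendsto (fun l => P.g (wHat l) ⬝ᵥ (P.arc (η l) (wHat l) (α l) - η l)) atTop (𝓝 0) := by
  have hlim := tendsto_atTop_ciSup (h.monotone_dual hα hσ.le hβ)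
    ⟨P.fTilde wk w, by rintro _ ⟨l, rfl⟩; exact h.dual_le_fTilde hw hg l⟩
  have hdiff := ((hlim.comp (tendsto_add_atTop_nat 1)).sub hlim).div_const σ
  rw [sub_self, zero_div] at hdiff
  refine squeeze_zero
    (fun l => dotProduct_arc_sub_nonneg (h.nonneg l) _ (h.step_pos hα hβ l).le)
    (fun l => ?_) hdiff
  rw [le_div_iff₀ hσ, mul_comm]
  exact h.sufficient_increase l

/-- Limits of the iterates are complementary. -/
theorem complementarity_of_tendsto (h : P.IsInnerLoop wk αinit σ β η α wHat) (hα : 0 < αinit)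
    (hσ : σ ∈ Set.Ioo (0 : ℝ) 1) (hβ : β ∈ Set.Ioo (0 : ℝ) 1)
    {w : Fin N → ℝ} (hw : w ∈ P.W) (hg : ∀ c, P.g w c < 0)
    {U : Ultrafilter ℕ} (hU : (U : Filter ℕ) ≤ atTop) {ζ : Fin p ⊕ Fin q → ℝ}
    (hζ : Tendsto η U (𝓝 ζ)) (hζ0 : ∀ c, 0 ≤ ζ c) {v : Fin N → ℝ}
    (hv : Tendsto wHat U (𝓝 v)) (huniq : ∀ u, P.IsQPSolution (P.lam wk) ζ u → u = v)
    (c : Fin p ⊕ Fin q) : P.g v c ≤ 0 ∧ ζ c * P.g v c = 0 := by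
  obtain ⟨t, ht, hle⟩ := (isCompact_Icc (a := (0 : ℝ)) (b := αinit)).ultrafilter_le_nhds (U.map α)
    (tendsto_principal.2 <| Eventually.of_forall fun l =>
      ⟨(h.step_pos hα hβ.1 l).le, h.step_le hα hβ l⟩)
  have hαt : Tendsto α U (𝓝 t) := hle
  have hgv : Tendsto (fun l => P.g (wHat l)) U (𝓝 (P.g v)) := (P.continuous_g.tendsto v).comp hv
  have harc : ∀ {s : ℕ → ℝ} {s₀ : ℝ}, Tendsto s U (𝓝 s₀) →
      Tendsto (fun l => P.arc (η l) (wHat l) (s l)) U (𝓝 (P.arc ζ v s₀)) := fun hs =>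
    (P.continuous_arc.tendsto (ζ, v, _)).comp (hζ.prodMk_nhds (hv.prodMk_nhds hs))
  have hdot : ∀ {s : ℕ → ℝ} {s₀ : ℝ}, Tendsto s U (𝓝 s₀) →
      Tendsto (fun l => P.g (wHat l) ⬝ᵥ (P.arc (η l) (wHat l) (s l) - η l)) U
        (𝓝 (P.g v ⬝ᵥ (P.arc ζ v s₀ - ζ))) := fun hs =>
    tendsto_finsetSum _ fun c _ =>
      (tendsto_pi_nhds.1 hgv c).mul (tendsto_pi_nhds.1 ((harc hs).sub hζ) c)
  -- If the steps tend to 0, failed trials give stationarity, measured at the fixed step `αinit`; if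
  -- they stay away from 0, the vanishing predicted increase does.
  rcases ht.1.eq_or_lt with rfl | ht0
  · refine complementarity_of_dotProduct_arc_sub_eq_zero hζ0 hα (le_antisymm ?_
      (dotProduct_arc_sub_nonneg hζ0 v hα.le)) c
    have hdiv : Tendsto (fun l => α l / β) U (𝓝 0) := by simpa using hαt.div_const β
    choose u hu using fun l => P.exists_isQPSolution wk ⟨w, hw⟩ (P.arc (η l) (wHat l) (α l / β))
    have harc0 : P.arc ζ v 0 = ζ := by
      funext c
      simp [arc, hζ0 c]
    -- The failed trial multipliers also tend to `ζ`, so their QP solutions share the limit `v` and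
    -- the error bound vanishes.
    have huv : Tendsto u U (𝓝 v) :=
      tendsto_of_isQPSolution (Eventually.of_forall hu) (harc0 ▸ harc hdiv) huniq
    have hgu : Tendsto (fun l => P.g (u l)) U (𝓝 (P.g v)) := (P.continuous_g.tendsto v).comp huv
    have hrhs : Tendsto
        (fun l => αinit * ∑ c, |P.g (wHat l) c - P.g (u l) c| * |P.g (wHat l) c|) U (𝓝 0) := by
      have : Tendsto
          (fun l => αinit * ∑ c, |P.g (wHat l) c - P.g (u l) c| * |P.g (wHat l) c|) U
          (𝓝 (αinit * ∑ c, |P.g v c - P.g v c| * |P.g v c|)) :=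
        (tendsto_finsetSum _ fun c _ => ((tendsto_pi_nhds.1 hgv c).sub
          (tendsto_pi_nhds.1 hgu c)).abs.mul (tendsto_pi_nhds.1 hgv c).abs).const_mul _
      simpa using this
    have hlim := le_of_tendsto_of_tendsto
      ((hdot (tendsto_const_nhds (x := αinit))).const_mul (1 - σ)) hrhs (by
        filter_upwards [hdiv.eventually_lt_const hα] with l hl
        have hpos := h.step_pos hα hβ.1 l
        refine dotProduct_arc_sub_le_of_not_armijoTest (h.nonneg l) (div_pos hpos hβ.1) hl.le
          hσ.2 (hu l) (h.not_armijoTest_div hα hβ (lt_of_le_of_lt ?_ hl))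
        exact le_div_self hpos.le hβ.1 hβ.2.le)
    exact nonpos_of_mul_nonpos_right hlim (sub_pos.2 hσ.2)
  · exact complementarity_of_dotProduct_arc_sub_eq_zero hζ0 ht0 (tendsto_nhds_unique (hdot hαt)
      ((h.tendsto_dotProduct_step hα hσ.1 hβ.1 hw hg).mono_left hU)) c

end IsInnerLoop

end MVP

theorem proposition1 {N p q : ℕ} (P : MVP N p q)
    (hS : ∀ j, (P.S j).PosDef)
    (hslater : ∃ w, P.IsStrictlyFeasible w)
    (hF : ∀ w ∈ P.K, DifferentiableAt ℝ P.F (P.x w, P.y w))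
    (hA : P.RationalTradeoff)
    (wk : Fin N → ℝ) (hwk : wk ∈ P.K)
    (αinit σ β : ℝ) (hαinit : 0 < αinit) (hσ : σ ∈ Set.Ioo (0 : ℝ) 1) (hβ : β ∈ Set.Ioo (0 : ℝ) 1)
    (η : ℕ → Fin p ⊕ Fin q → ℝ) (α : ℕ → ℝ) (wHat : ℕ → Fin N → ℝ)
    (hrun : P.IsInnerLoop wk αinit σ β η α wHat)
    -- the QP surrogate problem has a unique solution at every iterate and every limit of iterates
    (huniq : ∀ ζ ∈ closure (Set.range η), ∃! w, P.IsQPSolution (P.lam wk) ζ w) :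
    ∃ wstar : Fin N → ℝ,
      P.IsSubproblemSolution wk wstar ∧
      (∀ v, P.IsSubproblemSolution wk v → v = wstar) ∧
      Tendsto wHat atTop (𝓝 wstar) := by
  obtain ⟨w₀, hw₀, hx₀, hy₀⟩ := hslater
  have hg₀ : ∀ c, P.g w₀ c < 0 := by
    rintro (i | j)
    · exact sub_neg.2 (hx₀ i)
    · exact sub_neg.2 (hy₀ j)
  have key : ∀ U : Ultrafilter ℕ, (U : Filter ℕ) ≤ atTop → ∃ v, Tendsto wHat U (𝓝 v) ∧
      P.IsSubproblemSolution wk v ∧ ∀ u, P.IsSubproblemSolution wk u → u = v := by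
    intro U hU
    obtain ⟨M, hM⟩ := hrun.exists_forall_le hαinit hσ.1.le hβ.1 hw₀ hg₀
    obtain ⟨ζ, hζM, hle⟩ := (isCompact_Icc (a := (0 : Fin p ⊕ Fin q → ℝ))
      (b := M)).ultrafilter_le_nhds (U.map η) (tendsto_principal.2 (Eventually.of_forall hM))
    have hζ : Tendsto η U (𝓝 ζ) := hle
    obtain ⟨v, hv, huv⟩ := huniq ζ
      (mem_closure_of_tendsto hζ (Eventually.of_forall fun l => ⟨l, rfl⟩))
    have hwv := MVP.tendsto_of_isQPSolution (Eventually.of_forall hrun.qp) hζ huv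
    exact ⟨v, hwv, hv.isSubproblemSolution hζM.1
      (hrun.complementarity_of_tendsto hαinit hσ hβ hw₀ hg₀ hU hζ hζM.1 hwv huv) huv⟩
  -- One ultrafilter supplies the optimum; its uniqueness identifies the limits along all others.
  obtain ⟨wstar, -, hsol, hstar⟩ := key (Ultrafilter.of atTop) (Ultrafilter.of_le atTop)
  refine ⟨wstar, hsol, hstar, (tendsto_iff_ultrafilter _ _ _).2 fun U hU => ?_⟩
  obtain ⟨v, hv, hvsol, -⟩ := key U hU
  exact hstar v hvsol ▸ hv
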